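/- Let $M$ be a compact Hausdorff smooth ($C^\infty$) manifold without boundary, of dimension $n\ge 0$, and let $d\ge 0$. Let $C^\infty(M,\mathbb R^d)$ be the real vector space of smooth maps $M\to\mathbb R^d$ with the $C^\infty$ topology, i.e. uniform convergence, on compact subsets of chart images, of all derivatives of the maps expressed in smooth charts of $M$. Let - $\operatorname{Imm}(M,\mathbb R^d)$ be the set of all $q\in C^\infty(M,\mathbb R^d)$ such that $T_xq$ is injective for every $x\in M$ (immersions); - $\operatorname{Imm}_f(M,\mathbb R^d)$ be the set of all $q\in\operatorname{Imm}(M,\mathbb R^d)$ such that $q\circ\varphi=q$ implies $\varphi=\mathrm{Id}_M$ for every smooth diffeomorphism $\varphi$ of $M$ (free immersions); - $\operatorname{Emb}(M,\mathbb R^d)$ be the set of all $q\in\operatorname{Imm}(M,\mathbb R^d)$ that are homeomorphisms onto their image (embeddings). Then $C^\infty(M,\mathbb R^d)$ is a Fréchet space (a complete, metrizable, Hausdorff, locally convex topological vector space), and $\operatorname{Imm}(M,\mathbb R^d)$, $\operatorname{Imm}_f(M,\mathbb R^d)$ and $\operatorname{Emb}(M,\mathbb R^d)$ are open subsets of it.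 Hence each of them, with the subspace topology and the charts it inherits as an open subset, is a smooth Fréchet manifold modelled on $C^\infty(M,\mathbb R^d)$: a Hausdorff space with an atlas of charts onto open subsets of this Fréchet space, whose transition maps are smooth (all iterated directional derivatives exist and are jointly continuous). -/

import Mathlib

open scoped Manifold ContDiff Topology

universe u v w

/-- A real Fréchet space: a Hausdorff, metrizable, locally convex real topological vector space
that is complete for the uniform structure defined by its additive group topology. -/
structure IsFrechetSpace (F : Type u) [AddCommGroup F] [Module ℝ F] [TopologicalSpace F] :
    Prop where
  isTopologicalAddGroup : IsTopologicalAddGroup F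
  continuousSMul : ContinuousSMul ℝ F
  locallyConvexSpace : LocallyConvexSpace ℝ F
  t2Space : T2Space F
  metrizableSpace : TopologicalSpace.MetrizableSpace F
  completeSpace : @CompleteSpace F (IsTopologicalAddGroup.rightUniformSpace F)

/-- `C^k` maps on subsets `U` (meant to be open) of topological vector spaces, in the usual sense of
calculus in Fréchet spaces: `f` is `C^0` on `U` if it is continuous there, and `C^(k+1)` if it is
continuous, all directional derivatives `D f (x, h) = lim_{t → 0} (f (x + t h) - f x) / t` with
`x ∈ U` exist, and `D f` is `C^k` on `U × F`. -/
def FrechetContDiffOn {G : Type v} [AddCommGroup G] [Module ℝ G] [TopologicalSpace G] :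
    (k : ℕ) → {F : Type u} → [AddCommGroup F] → [Module ℝ F] → [TopologicalSpace F] →
      (F → G) → Set F → Prop
  | 0, _, _, _, _, f, U => ContinuousOn f U
  | k + 1, F, _, _, _, f, U => ContinuousOn f U ∧ ∃ D : F × F → G,
      (∀ x ∈ U, ∀ h : F,
        Filter.Tendsto (fun t : ℝ => t⁻¹ • (f (x + t • h) - f x)) (𝓝[≠] 0) (𝓝 (D (x, h)))) ∧
      FrechetContDiffOn k D (U ×ˢ Set.univ)

/-- Smooth maps on (open) subsets of a topological vector space: `C^k` for all finite `k`. -/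
def FrechetSmoothOn {F : Type u} {G : Type v} [AddCommGroup F] [Module ℝ F] [TopologicalSpace F]
    [AddCommGroup G] [Module ℝ G] [TopologicalSpace G] (f : F → G) (U : Set F) : Prop :=
  ∀ k : ℕ, FrechetContDiffOn k f U

/-- A smooth Fréchet manifold modelled on `F`: a Hausdorff space with an atlas of charts onto open
subsets of the Fréchet space `F`, all of whose transition maps are smooth. -/
structure IsFrechetManifold (F : Type u) [AddCommGroup F] [Module ℝ F] [TopologicalSpace F]
    (X : Type w) [TopologicalSpace X] [ChartedSpace F X] : Prop where
  isFrechetSpace : IsFrechetSpace F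
  t2Space : T2Space X
  smooth_transition : ∀ e ∈ atlas F X, ∀ e' ∈ atlas F X,
    FrechetSmoothOn (e.symm ≫ₕ e') (e.symm ≫ₕ e').source

section SmoothMaps

variable (n d : ℕ) (M : Type u) [TopologicalSpace M] [ChartedSpace (EuclideanSpace ℝ (Fin n)) M]

/-- The real vector space `C^∞(M, ℝ^d)`. -/
abbrev SmoothMaps : Type u :=
  C^∞⟮𝓡 n, M; 𝓘(ℝ, EuclideanSpace ℝ (Fin d)), EuclideanSpace ℝ (Fin d)⟯

/-- The `C^∞` topology: the coarsest topology for which, for every smooth chart `e` of `M` and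
every order `k`, the map `f ↦ D^k (f ∘ e⁻¹)` is continuous with respect to uniform convergence on
compact subsets of the chart image. -/
noncomputable instance SmoothMaps.instTopologicalSpace : TopologicalSpace (SmoothMaps n d M) :=
  ⨅ (e ∈ IsManifold.maximalAtlas (𝓡 n) ∞ M) (k : ℕ),
    TopologicalSpace.induced
      (fun f : SmoothMaps n d M =>
        UniformOnFun.ofFun {K : Set (EuclideanSpace ℝ (Fin n)) | IsCompact K ∧ K ⊆ e.target}
          (iteratedFDeriv ℝ k (f ∘ e.symm)))
      (UniformOnFun.topologicalSpace _ _ _)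

/-- `Imm(M, ℝ^d)`: smooth maps whose differential is injective at every point. -/
def Imm : Set (SmoothMaps n d M) :=
  {q | ∀ x : M, Function.Injective (mfderiv (𝓡 n) 𝓘(ℝ, EuclideanSpace ℝ (Fin d)) q x)}

/-- `Imm_f(M, ℝ^d)`: immersions `q` such that `q ∘ φ = q` for a diffeomorphism `φ` of `M` only if
`φ` is the identity. -/
def ImmFree : Set (SmoothMaps n d M) :=
  {q | q ∈ Imm n d M ∧ ∀ φ : M ≃ₘ^∞⟮𝓡 n, 𝓡 n⟯ M, q ∘ φ = q → φ = Diffeomorph.refl (𝓡 n) M ∞}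

/-- `Emb(M, ℝ^d)`: immersions that are homeomorphisms onto their image. -/
def Emb : Set (SmoothMaps n d M) :=
  {q | q ∈ Imm n d M ∧ Topology.IsEmbedding q}

end SmoothMaps

/-! Derivatives in all charts over compact sets map $C^\infty(M,\mathbb R^d)$ linearly and
injectively into a product of Banach spaces $C(K,\cdot)$, and the $C^\infty$ topology is the induced
one. The image is closed because a locally uniform limit of derivatives is the derivative of the
limit; this gives completeness. Finitely many compact chart pieces cover $M$ and control all other
jets by the chain rule, so countably many norms suffice; this gives metrizability.

Openness rests on one local estimate, `eventually_injective_mfderiv_and_injOn`: around a point where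
$q$ is immersive, every $f$ that is $C^1$-close to $q$ is immersive and injective on a fixed
neighbourhood. Compactness of $M$ then handles immersions and, with separation away from the
diagonal, embeddings.

For free immersions, suppose non-free $f$ accumulate at a free $q$. By
`exists_continuous_limit_of_comp_eq` their symmetries converge along an ultrafilter to a symmetry of
$q$, which is smooth because $q$ is an immersion, and hence is the identity. Points $z_f$ moved by
the symmetries $\varphi_f$ then give distinct pairs $(\varphi_f(z_f), z_f)$ with equal images under
$f$ that merge in the limit, against the local estimate. -/

open Set Filter Topology

/-! ### The $C^\infty$ topology as a vector space topology induced by jets -/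

namespace SmoothMaps

/-- A smooth chart of `M` together with a compact subset of its image. -/
structure CompactChart (n : ℕ) (M : Type u) [TopologicalSpace M]
    [ChartedSpace (EuclideanSpace ℝ (Fin n)) M] where
  /-- The chart. -/
  chart : OpenPartialHomeomorph M (EuclideanSpace ℝ (Fin n))
  mem : chart ∈ IsManifold.maximalAtlas (𝓡 n) ∞ M
  /-- The compact subset of the image of the chart. -/
  carrier : Set (EuclideanSpace ℝ (Fin n))
  isCompact : IsCompact carrier
  subset : carrier ⊆ chart.target

variable {n d : ℕ} {M : Type u} [TopologicalSpace M] [ChartedSpace (EuclideanSpace ℝ (Fin n)) M]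

instance (c : CompactChart n M) : CompactSpace c.carrier := isCompact_iff_compactSpace.1 c.isCompact

theorem contDiffOn_comp_symm (f : SmoothMaps n d M)
    {e : OpenPartialHomeomorph M (EuclideanSpace ℝ (Fin n))}
    (he : e ∈ IsManifold.maximalAtlas (𝓡 n) ∞ M) : ContDiffOn ℝ ∞ (f ∘ e.symm) e.target := by
  rw [← contMDiffOn_iff_contDiffOn]
  exact f.contMDiff.comp_contMDiffOn (contMDiffOn_symm_of_mem_maximalAtlas he)

theorem contDiffAt_comp_symm (f : SmoothMaps n d M)
    {e : OpenPartialHomeomorph M (EuclideanSpace ℝ (Fin n))}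
    (he : e ∈ IsManifold.maximalAtlas (𝓡 n) ∞ M) {z : EuclideanSpace ℝ (Fin n)}
    (hz : z ∈ e.target) : ContDiffAt ℝ ∞ (f ∘ e.symm) z :=
  (contDiffOn_comp_symm f he).contDiffAt (e.open_target.mem_nhds hz)

theorem continuousOn_iteratedFDeriv_comp_symm (f : SmoothMaps n d M)
    {e : OpenPartialHomeomorph M (EuclideanSpace ℝ (Fin n))}
    (he : e ∈ IsManifold.maximalAtlas (𝓡 n) ∞ M) (k : ℕ) :
    ContinuousOn (iteratedFDeriv ℝ k (f ∘ e.symm)) e.target :=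
  ((contDiffOn_comp_symm f he).continuousOn_iteratedFDerivWithin (m := k)
    (by exact_mod_cast le_top) e.open_target.uniqueDiffOn).congr
    fun _ hz => (iteratedFDerivWithin_of_isOpen k e.open_target hz).symm

/-- The `k`-th derivative of a smooth map, in a chart, on a compact subset of the chart image. -/
noncomputable def jet (c : CompactChart n M) (k : ℕ) : SmoothMaps n d M →ₗ[ℝ]
    C(c.carrier, EuclideanSpace ℝ (Fin n) [×k]→L[ℝ] EuclideanSpace ℝ (Fin d)) where
  toFun f := ⟨fun z => iteratedFDeriv ℝ k (f ∘ c.chart.symm) z,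
    ((continuousOn_iteratedFDeriv_comp_symm f c.mem k).mono c.subset).domRestrict⟩
  map_add' f g := by
    ext1 z
    have hle : ((k : ℕ∞) : WithTop ℕ∞) ≤ ∞ := by exact_mod_cast le_top
    exact iteratedFDeriv_add_apply ((contDiffAt_comp_symm f c.mem (c.subset z.2)).of_le hle)
      ((contDiffAt_comp_symm g c.mem (c.subset z.2)).of_le hle)
  map_smul' r f := by
    ext1 z
    have hle : ((k : ℕ∞) : WithTop ℕ∞) ≤ ∞ := by exact_mod_cast le_top
    exact iteratedFDeriv_const_smul_apply
      ((contDiffAt_comp_symm f c.mem (c.subset z.2)).of_le hle)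

/-- All derivatives in all charts on all compact subsets of chart images. -/
noncomputable def jets : SmoothMaps n d M →ₗ[ℝ] (i : CompactChart n M × ℕ) →
    C(i.1.carrier, EuclideanSpace ℝ (Fin n) [×i.2]→L[ℝ] EuclideanSpace ℝ (Fin d)) :=
  LinearMap.pi fun i => jet i.1 i.2

/-- On a compact set the norm topology of continuous maps is that of uniform convergence, so the
defining topology comes from linear maps into normed spaces and inherits their vector space
properties. -/
theorem topologicalSpace_eq_iInf :
    (SmoothMaps.instTopologicalSpace n d M) = ⨅ i : CompactChart n M × ℕ,
      TopologicalSpace.induced (jet i.1 i.2) inferInstance := by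
  have key : ∀ (c : CompactChart n M) (k : ℕ),
      TopologicalSpace.induced (jet (d := d) c k) inferInstance =
      TopologicalSpace.induced (fun f : SmoothMaps n d M =>
        UniformFun.ofFun (c.carrier.domRestrict (iteratedFDeriv ℝ k (f ∘ c.chart.symm))))
        (UniformFun.topologicalSpace _ _) := by
    intro c k
    exact (congrArg _ ContinuousMap.isUniformEmbedding_uniformFunOfFun.isInducing.eq_induced).trans
      induced_compose
  simp only [SmoothMaps.instTopologicalSpace, UniformOnFun.topologicalSpace_eq, induced_iInf,
    induced_compose]
  apply le_antisymm
  · refine le_iInf fun ⟨c, k⟩ => ?_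
    rw [key]
    exact iInf_le_of_le c.chart (iInf_le_of_le c.mem (iInf_le_of_le k
      (iInf_le_of_le c.carrier (iInf_le_of_le ⟨c.isCompact, c.subset⟩ le_rfl))))
  · refine le_iInf fun e => le_iInf fun he => le_iInf fun k => le_iInf fun K => le_iInf fun hK => ?_
    refine iInf_le_of_le (⟨e, he, K, hK.1, hK.2⟩, k) ?_
    rw [key]
    rfl

theorem isInducing_jets : IsInducing (jets : SmoothMaps n d M → _) := by
  constructor
  rw [topologicalSpace_eq_iInf, Pi.topologicalSpace, induced_iInf]
  simp only [induced_compose]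
  rfl

theorem continuous_jet (c : CompactChart n M) (k : ℕ) :
    Continuous (jet c k : SmoothMaps n d M → _) :=
  (continuous_apply (c, k)).comp isInducing_jets.continuous

instance : IsTopologicalAddGroup (SmoothMaps n d M) :=
  isInducing_jets.topologicalAddGroup _

instance : ContinuousSMul ℝ (SmoothMaps n d M) :=
  isInducing_jets.continuousSMul continuous_id (by intros; exact map_smul _ _ _)

instance : LocallyConvexSpace ℝ (SmoothMaps n d M) := by
  rw [isInducing_jets.eq_induced]
  exact LocallyConvexSpace.induced _

variable [IsManifold (𝓡 n) ∞ M]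

/-- The preferred chart at `x` with a given compact subset of its image. -/
noncomputable def CompactChart.at (x : M) (K : Set (EuclideanSpace ℝ (Fin n))) (hK : IsCompact K)
    (hKx : K ⊆ (chartAt (EuclideanSpace ℝ (Fin n)) x).target) : CompactChart n M where
  chart := chartAt _ x
  mem := IsManifold.chart_mem_maximalAtlas x
  carrier := K
  isCompact := hK
  subset := hKx

theorem injective_jets : Function.Injective (jets : SmoothMaps n d M → _) := by
  intro f g h
  ext1 x
  have h0 : jet (CompactChart.at x {chartAt _ x x} isCompact_singleton (by simp)) 0 f =
      jet (CompactChart.at x {chartAt _ x x} isCompact_singleton (by simp)) 0 g := congr_fun h (_, 0)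
  have h1 : iteratedFDeriv ℝ 0 (f ∘ (chartAt (EuclideanSpace ℝ (Fin n)) x).symm) (chartAt _ x x) =
      iteratedFDeriv ℝ 0 (g ∘ (chartAt (EuclideanSpace ℝ (Fin n)) x).symm) (chartAt _ x x) :=
    DFunLike.congr_fun h0 ⟨chartAt _ x x, rfl⟩
  simpa using congr_arg (fun m => m 0) h1

instance : T2Space (SmoothMaps n d M) :=
  (IsEmbedding.mk isInducing_jets injective_jets).t2Space

end SmoothMaps

/-! ### Metrizability: finitely many charts suffice -/

namespace SmoothMaps

variable {n d : ℕ} {M : Type u} [TopologicalSpace M] [ChartedSpace (EuclideanSpace ℝ (Fin n)) M]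

/-- Chain rule of order `k` for the transition map `τ`. The overlap of the two pieces is compact,
since compact sets in the Hausdorff space `M` are closed, so the derivatives of `τ` are bounded
there independently of `f`. -/
theorem norm_iteratedFDeriv_le_sum_norm_jet [T2Space M] (c c' : CompactChart n M) (k : ℕ) :
    ∃ C : ℝ, 0 ≤ C ∧ ∀ f : SmoothMaps n d M, ∀ z ∈ c.carrier,
      c.chart.symm z ∈ c'.chart.symm '' c'.carrier →
      ‖iteratedFDeriv ℝ k (f ∘ c.chart.symm) z‖ ≤
        C * ∑ j ∈ Finset.range (k + 1), ‖jet c' j f‖ := by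
  set s := c.chart.target ∩ c.chart.symm ⁻¹' c'.chart.source with hs
  have hso : IsOpen s := c.chart.isOpen_inter_preimage_symm c'.chart.open_source
  set τ := c'.chart ∘ c.chart.symm with hτ
  have hτs : ContDiffOn ℝ ∞ τ s := by
    rw [← contMDiffOn_iff_contDiffOn]
    exact (contMDiffOn_of_mem_maximalAtlas c'.mem).comp
      ((contMDiffOn_symm_of_mem_maximalAtlas c.mem).mono inter_subset_left) inter_subset_right
  have hle : ∀ j : ℕ, ((j : ℕ∞) : WithTop ℕ∞) ≤ ∞ := fun j => by exact_mod_cast le_top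
  have himage : IsCompact (c'.chart.symm '' c'.carrier) :=
    c'.isCompact.image_of_continuousOn (c'.chart.continuousOn_symm.mono c'.subset)
  have hS : IsCompact (c.carrier ∩ c.chart.symm ⁻¹' (c'.chart.symm '' c'.carrier)) :=
    c.isCompact.of_isClosed_subset
      ((c.chart.continuousOn_symm.mono c.subset).preimage_isClosed_of_isClosed
        c.isCompact.isClosed himage.isClosed) inter_subset_left
  have hSs : c.carrier ∩ c.chart.symm ⁻¹' (c'.chart.symm '' c'.carrier) ⊆ s := by
    rintro z ⟨hz, w, hw, hwz⟩
    refine ⟨c.subset hz, ?_⟩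
    rw [mem_preimage, ← hwz]
    exact c'.chart.map_target (c'.subset hw)
  have hbound : ∀ j : ℕ, ∃ B : ℝ, ∀ z ∈ c.carrier ∩ c.chart.symm ⁻¹' (c'.chart.symm '' c'.carrier),
      ‖iteratedFDerivWithin ℝ j τ s z‖ ≤ B := fun j =>
    hS.exists_bound_of_continuousOn
      ((hτs.continuousOn_iteratedFDerivWithin (hle j) hso.uniqueDiffOn).mono hSs)
  choose B hB using hbound
  -- The composition estimate needs the `i`-th derivative of `τ` bounded by `D ^ i`; as `D ≥ 1`, it
  -- is enough that `D` dominates every `B j`.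
  set D : ℝ := 1 + ∑ j ∈ Finset.range (k + 1), |B j| with hD
  have hD1 : 1 ≤ D := le_add_of_nonneg_right (Finset.sum_nonneg fun _ _ => abs_nonneg _)
  refine ⟨k.factorial * D ^ k, by positivity, fun f z hz hzc => ?_⟩
  have hzs : z ∈ s := hSs ⟨hz, hzc⟩
  have hEq : EqOn (f ∘ c.chart.symm) ((f ∘ c'.chart.symm) ∘ τ) s := by
    intro y hy
    simp [hτ, c'.chart.left_inv hy.2]
  rw [← iteratedFDerivWithin_of_isOpen k hso hzs, iteratedFDerivWithin_congr hEq hzs k]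
  have hmaps : MapsTo τ s c'.chart.target := fun y hy => c'.chart.map_source hy.2
  have hτz : τ z ∈ c'.carrier := by
    obtain ⟨w, hw, hwz⟩ := hzc
    simpa [hτ, ← hwz, c'.chart.right_inv (c'.subset hw)] using hw
  refine (norm_iteratedFDerivWithin_comp_le
    (C := ∑ j ∈ Finset.range (k + 1), ‖jet c' j f‖) (D := D)
    (contDiffOn_comp_symm f c'.mem) hτs (hle k)
    c'.chart.open_target.uniqueDiffOn hso.uniqueDiffOn hmaps hzs ?_ ?_).trans_eq (by ring)
  · intro i hi
    rw [iteratedFDerivWithin_of_isOpen i c'.chart.open_target (hmaps hzs)]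
    exact ((jet c' i f).norm_coe_le_norm ⟨τ z, hτz⟩).trans
      (Finset.single_le_sum (f := fun j => ‖jet c' j f‖) (fun j _ => norm_nonneg (jet c' j f))
        (Finset.mem_range.2 (by omega)))
  · intro i hi hik
    refine ((hB i z ⟨hz, hzc⟩).trans (le_abs_self _)).trans ?_
    refine le_trans ?_ (le_self_pow₀ hD1 (by omega))
    exact (Finset.single_le_sum (f := fun j => |B j|) (fun _ _ => abs_nonneg _)
        (Finset.mem_range.2 (by omega))).trans (le_add_of_nonneg_left zero_le_one)

theorem exists_finite_compactChart_cover [IsManifold (𝓡 n) ∞ M] [CompactSpace M] :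
    ∃ s : Finset (CompactChart n M),
    ∀ x : M, ∃ c ∈ s, x ∈ c.chart.symm '' c.carrier := by
  classical
  have h : ∀ x : M, ∃ c : CompactChart n M, c.chart.symm '' c.carrier ∈ 𝓝 x := by
    intro x
    obtain ⟨r, hr, hr'⟩ := Metric.nhds_basis_closedBall.mem_iff.1
      ((chartAt (EuclideanSpace ℝ (Fin n)) x).open_target.mem_nhds
        (mem_chart_target (EuclideanSpace ℝ (Fin n)) x))
    refine ⟨CompactChart.at x _ (isCompact_closedBall _ r) hr', ?_⟩
    have := (chartAt (EuclideanSpace ℝ (Fin n)) x).symm.image_mem_nhds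
      (mem_chart_target (EuclideanSpace ℝ (Fin n)) x) (Metric.closedBall_mem_nhds _ hr)
    rwa [OpenPartialHomeomorph.left_inv _ (mem_chart_source _ x)] at this
  choose c hc using h
  obtain ⟨t, ht⟩ := CompactSpace.elim_nhds_subcover _ hc
  refine ⟨t.image c, fun x => ?_⟩
  have hx : x ∈ ⋃ y ∈ t, (c y).chart.symm '' (c y).carrier := ht ▸ mem_univ x
  simp only [mem_iUnion] at hx
  obtain ⟨y, hy, hxy⟩ := hx
  exact ⟨c y, Finset.mem_image_of_mem _ hy, hxy⟩

theorem exists_norm_jet_le [T2Space M] (s : Finset (CompactChart n M))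
    (hs : ∀ x : M, ∃ c ∈ s, x ∈ c.chart.symm '' c.carrier) (c : CompactChart n M) (k : ℕ) :
    ∃ C : ℝ, ∀ f : SmoothMaps n d M, ‖jet c k f‖ ≤
      C * ∑ c' : s, ∑ j ∈ Finset.range (k + 1), ‖jet c'.1 j f‖ := by
  choose C hC0 hC using fun c' : s => norm_iteratedFDeriv_le_sum_norm_jet (d := d) c c'.1 k
  have hCsum : ∀ c', C c' ≤ ∑ c', C c' := fun c' =>
    Finset.single_le_sum (fun i _ => hC0 i) (Finset.mem_univ c')
  have h0 : ∀ (f : SmoothMaps n d M) (c' : s), 0 ≤ ∑ j ∈ Finset.range (k + 1), ‖jet c'.1 j f‖ :=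
    fun f c' => Finset.sum_nonneg fun j _ => norm_nonneg (jet c'.1 j f)
  refine ⟨∑ c', C c', fun f => ?_⟩
  refine (ContinuousMap.norm_le _ (mul_nonneg (Finset.sum_nonneg fun i _ => hC0 i)
    (Finset.sum_nonneg fun i _ => h0 f i))).2 fun z => ?_
  obtain ⟨c', hc', hz⟩ := hs (c.chart.symm z)
  refine (hC ⟨c', hc'⟩ f z z.2 hz).trans ?_
  exact mul_le_mul (hCsum ⟨c', hc'⟩) (Finset.single_le_sum
    (f := fun c' : s => ∑ j ∈ Finset.range (k + 1), ‖jet c'.1 j f‖)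
    (fun i _ => h0 f i) (Finset.mem_univ (⟨c', hc'⟩ : s))) (h0 f _)
    (Finset.sum_nonneg fun i _ => hC0 i)

/-- The index set `s × ℕ` is countable, so the topology embeds in a countable product of metric
spaces. For linear maps it suffices to compare neighbourhoods of zero. -/
theorem isInducing_jets_finset [T2Space M] (s : Finset (CompactChart n M))
    (hs : ∀ x : M, ∃ c ∈ s, x ∈ c.chart.symm '' c.carrier) :
    IsInducing fun (f : SmoothMaps n d M) (i : s × ℕ) => jet i.1.1 i.2 f := by
  let T : SmoothMaps n d M →ₗ[ℝ] (i : s × ℕ) →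
      C(i.1.1.carrier, EuclideanSpace ℝ (Fin n) [×i.2]→L[ℝ] EuclideanSpace ℝ (Fin d)) :=
    LinearMap.pi fun i => jet i.1.1 i.2
  have hT : Continuous T := continuous_pi fun i => continuous_jet _ _
  refine (IsTopologicalAddGroup.isInducing_iff_nhds_zero (f := T)).2 (le_antisymm ?_ ?_)
  · have := hT.tendsto 0
    rw [map_zero] at this
    exact this.le_comap
  · rw [isInducing_jets.nhds_eq_comap, ← tendsto_iff_comap, map_zero, tendsto_pi_nhds]
    rintro ⟨c, k⟩
    obtain ⟨C, hC⟩ := exists_norm_jet_le (d := d) s hs c k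
    refine tendsto_zero_iff_norm_tendsto_zero.2
      (squeeze_zero (fun f => norm_nonneg (jet c k f)) hC ?_)
    rw [show (0 : ℝ) = C * ∑ c' : s, ∑ j ∈ Finset.range (k + 1), 0 by simp]
    refine Tendsto.const_mul _ (tendsto_finsetSum _ fun c' _ => tendsto_finsetSum _ fun j _ => ?_)
    have h1 : Tendsto T (comap T (𝓝 0)) (𝓝 0) := tendsto_comap
    have h2 : Tendsto (fun f => jet c'.1 j f) (comap T (𝓝 0)) (𝓝 0) :=
      (tendsto_pi_nhds.1 h1) (c', j)
    rw [← norm_zero (E := C(c'.1.carrier,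
      EuclideanSpace ℝ (Fin n) [×j]→L[ℝ] EuclideanSpace ℝ (Fin d)))]
    exact h2.norm

instance [IsManifold (𝓡 n) ∞ M] [CompactSpace M] [T2Space M] :
    TopologicalSpace.MetrizableSpace (SmoothMaps n d M) := by
  obtain ⟨s, hs⟩ := exists_finite_compactChart_cover (n := n) (M := M)
  have := UniformSpace.metrizableSpace (X := (i : s × ℕ) →
    C(i.1.1.carrier, EuclideanSpace ℝ (Fin n) [×i.2]→L[ℝ] EuclideanSpace ℝ (Fin d)))
  exact (isInducing_jets_finset s hs).isEmbedding.metrizableSpace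

end SmoothMaps

/-! ### Completeness: limits of jets are jets -/

theorem hasFTaylorSeriesUpToOn_of_tendstoLocallyUniformlyOn {E G ι : Type*}
    [NormedAddCommGroup E] [NormedSpace ℝ E] [NormedAddCommGroup G] [NormedSpace ℝ G]
    {l : Filter ι} [NeBot l] {F : ι → E → G} {f : E → G} {p : E → FormalMultilinearSeries ℝ E G}
    {s : Set E} (hs : IsOpen s) (hF : ∀ i, ContDiffOn ℝ ∞ (F i) s)
    (hp : ∀ k, TendstoLocallyUniformlyOn (fun i => iteratedFDeriv ℝ k (F i)) (fun z => p z k) l s)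
    (hf : ∀ z ∈ s, Tendsto (fun i => F i z) l (𝓝 (f z))) : HasFTaylorSeriesUpToOn ∞ f p s where
  zero_eq z hz := by
    have h := ((hp 0).tendsto_at hz).eval_const 0
    simp only [iteratedFDeriv_zero_apply] at h
    exact tendsto_nhds_unique h (hf z hz)
  fderivWithin m _ z hz := by
    have h1 : TendstoLocallyUniformlyOn
        (fun i z => (iteratedFDeriv ℝ (m + 1) (F i) z).curryLeft)
        (fun z => (p z (m + 1)).curryLeft) l s :=
      (continuousMultilinearCurryLeftEquiv ℝ (fun _ : Fin (m + 1) => E) G).isometry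
        |>.uniformContinuous.comp_tendstoLocallyUniformlyOn (hp (m + 1))
    refine (hasFDerivAt_of_tendstoLocallyUniformlyOn hs h1 (fun i y hy => ?_)
      (fun y hy => (hp m).tendsto_at hy) hz).hasFDerivWithinAt
    have hd := (((hF i).contDiffAt (hs.mem_nhds hy)).differentiableAt_iteratedFDeriv
      (m := m) (by exact_mod_cast WithTop.coe_lt_top m)).hasFDerivAt
    rwa [fderiv_iteratedFDeriv] at hd
  cont m _ := by
    refine (hp m).continuousOn (Eventually.frequently (Eventually.of_forall fun i => ?_))
    exact ((hF i).continuousOn_iteratedFDerivWithin (m := m) (by exact_mod_cast le_top)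
      hs.uniqueDiffOn).congr fun _ hz => (iteratedFDerivWithin_of_isOpen m hs hz).symm

namespace SmoothMaps

variable {n d : ℕ} {M : Type u} [TopologicalSpace M] [ChartedSpace (EuclideanSpace ℝ (Fin n)) M]

theorem contMDiff_of_contDiffOn_comp_symm [IsManifold (𝓡 n) ∞ M] {f : M → EuclideanSpace ℝ (Fin d)}
    (hf : ∀ x : M, ContDiffOn ℝ ∞ (f ∘ (chartAt (EuclideanSpace ℝ (Fin n)) x).symm)
      (chartAt (EuclideanSpace ℝ (Fin n)) x).target) :
    ContMDiff (𝓡 n) 𝓘(ℝ, EuclideanSpace ℝ (Fin d)) ∞ f := by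
  intro x
  have h := (contMDiffOn_iff_contDiffOn.2 (hf x)).comp
    (contMDiffOn_chart (I := 𝓡 n) (n := ∞) (x := x))
    (fun y hy => OpenPartialHomeomorph.map_source _ hy)
  refine (h.congr fun y hy => ?_).contMDiffAt (chart_source_mem_nhds _ x)
  simp [OpenPartialHomeomorph.left_inv _ hy]

theorem tendstoUniformlyOn_iteratedFDeriv {ι : Type*} {l : Filter ι} {F : ι → SmoothMaps n d M}
    (c : CompactChart n M) (k : ℕ)
    {g : C(c.carrier, EuclideanSpace ℝ (Fin n) [×k]→L[ℝ] EuclideanSpace ℝ (Fin d))}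
    (h : Tendsto (fun i => jet c k (F i)) l (𝓝 g))
    {p : EuclideanSpace ℝ (Fin n) → EuclideanSpace ℝ (Fin n) [×k]→L[ℝ] EuclideanSpace ℝ (Fin d)}
    (hp : ∀ z : c.carrier, g z = p z) :
    TendstoUniformlyOn (fun i => iteratedFDeriv ℝ k (F i ∘ c.chart.symm)) p l c.carrier := by
  rw [tendstoUniformlyOn_iff_tendstoUniformly_comp_coe]
  have := ContinuousMap.tendsto_iff_tendstoUniformly.1 h
  rwa [show ⇑g = p ∘ (↑) from funext hp] at this

/-- A point `g` of the closure is the limit of jets along the filter `l`. Its components are locally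
uniform limits of derivatives, hence the derivatives of the pointwise limit `F`. -/
theorem isClosed_range_jets [IsManifold (𝓡 n) ∞ M] :
    IsClosed (range (jets : SmoothMaps n d M → _)) := by
  refine isClosed_of_closure_subset fun g hg => ?_
  let l : Filter (SmoothMaps n d M) := comap jets (𝓝 g)
  have hl : NeBot l := by
    rw [comap_neBot_iff]
    intro t ht
    obtain ⟨_, hy, f, rfl⟩ := mem_closure_iff_nhds.1 hg t ht
    exact ⟨f, hy⟩
  have hg : ∀ c k, Tendsto (fun f => jet c k f) l (𝓝 (g (c, k))) := fun c k =>
    tendsto_pi_nhds.1 (tendsto_comap : Tendsto jets l (𝓝 g)) (c, k)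
  -- Pointwise limits do not depend on the compact set, so they glue the components of `g` belonging
  -- to one chart.
  let p (e : OpenPartialHomeomorph M (EuclideanSpace ℝ (Fin n))) (z : EuclideanSpace ℝ (Fin n)) :
    FormalMultilinearSeries ℝ (EuclideanSpace ℝ (Fin n)) (EuclideanSpace ℝ (Fin d)) := fun k =>
      limUnder l fun f : SmoothMaps n d M => iteratedFDeriv ℝ k (f ∘ e.symm) z
  have hgz : ∀ (c : CompactChart n M) k (z : c.carrier),
      Tendsto (fun f : SmoothMaps n d M => iteratedFDeriv ℝ k (f ∘ c.chart.symm) z) l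
        (𝓝 (g (c, k) z)) := fun c k z =>
    ((continuous_eval_const z).tendsto _).comp (hg c k)
  have hgp : ∀ (c : CompactChart n M) k (z : c.carrier), g (c, k) z = p c.chart z k :=
    fun c k z => (hgz c k z).limUnder_eq.symm
  have hlu : ∀ e ∈ IsManifold.maximalAtlas (𝓡 n) ∞ M, ∀ k, TendstoLocallyUniformlyOn
      (fun (f : SmoothMaps n d M) => iteratedFDeriv ℝ k (f ∘ e.symm)) (fun z => p e z k) l
      e.target := by
    intro e he k
    refine (tendstoLocallyUniformlyOn_iff_forall_isCompact e.open_target).2 fun K hKe hK => ?_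
    exact tendstoUniformlyOn_iteratedFDeriv ⟨e, he, K, hK, hKe⟩ k (hg _ k) (hgp _ k)
  let F (x : M) : EuclideanSpace ℝ (Fin d) := limUnder l fun f : SmoothMaps n d M => f x
  have hF : ∀ e ∈ IsManifold.maximalAtlas (𝓡 n) ∞ M, ∀ z ∈ e.target,
      Tendsto (fun f : SmoothMaps n d M => f (e.symm z)) l (𝓝 (F (e.symm z))) := by
    intro e he z hz
    have h := ((hlu e he 0).tendsto_at hz).eval_const 0
    simp only [iteratedFDeriv_zero_apply] at h
    exact tendsto_nhds_limUnder ⟨_, h⟩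
  have hT : ∀ e ∈ IsManifold.maximalAtlas (𝓡 n) ∞ M,
      HasFTaylorSeriesUpToOn ∞ (F ∘ e.symm) (p e) e.target := fun e he =>
    hasFTaylorSeriesUpToOn_of_tendstoLocallyUniformlyOn e.open_target
      (fun f => contDiffOn_comp_symm f he) (hlu e he) (hF e he)
  refine ⟨⟨F, contMDiff_of_contDiffOn_comp_symm fun x =>
    (hT _ (IsManifold.chart_mem_maximalAtlas x)).contDiffOn⟩, ?_⟩
  ext1 ⟨c, k⟩
  ext1 z
  have hz := c.subset z.2
  refine Eq.trans ?_ (hgp c k z).symm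
  refine Eq.trans ?_ ((hT c.chart c.mem).eq_iteratedFDerivWithin_of_uniqueDiffOn
    (m := k) (by exact_mod_cast le_top) c.chart.open_target.uniqueDiffOn hz).symm
  exact (iteratedFDerivWithin_of_isOpen k c.chart.open_target hz).symm

theorem isFrechetSpace [IsManifold (𝓡 n) ∞ M] [CompactSpace M] [T2Space M] :
    IsFrechetSpace (SmoothMaps n d M) where
  isTopologicalAddGroup := inferInstance
  continuousSMul := inferInstance
  locallyConvexSpace := inferInstance
  t2Space := inferInstance
  metrizableSpace := inferInstance
  completeSpace := by
    -- `w` is the uniformity pulled back by `jets`, with its topology made definitionally the given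
    -- one. It is a group uniformity, hence the right uniformity of the goal.
    let v : UniformSpace (SmoothMaps n d M) := UniformSpace.comap jets inferInstance
    let w : UniformSpace (SmoothMaps n d M) := v.replaceTopology isInducing_jets.eq_induced
    have hwv : w = v := UniformSpace.replaceTopology_eq _ _
    have hu : IsUniformInducing (jets : SmoothMaps n d M → _) := ⟨by rw [hwv]; rfl⟩
    have (i : CompactChart n M × ℕ) : IsUniformAddGroup
      C(i.1.carrier, EuclideanSpace ℝ (Fin n) [×i.2]→L[ℝ] EuclideanSpace ℝ (Fin d)) :=
      @SeminormedAddCommGroup.to_isUniformAddGroup C(i.1.carrier,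
        EuclideanSpace ℝ (Fin n) [×i.2]→L[ℝ] EuclideanSpace ℝ (Fin d)) inferInstance
    have : IsUniformAddGroup (SmoothMaps n d M) := hu.isUniformAddGroup _
    rw [IsUniformAddGroup.rightUniformSpace_eq]
    exact (completeSpace_iff_isComplete_range hu).2 isClosed_range_jets.isComplete

end SmoothMaps

/-! ### Openness of immersions and embeddings -/

theorem AntilipschitzWith.injective_of_norm_sub_le {E G : Type*} [NormedAddCommGroup E]
    [NormedSpace ℝ E] [NormedAddCommGroup G] [NormedSpace ℝ G] {A B : E →L[ℝ] G} {K : NNReal}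
    (hA : AntilipschitzWith K A) {C : ℝ} (hC : K * C < 1) (hB : ‖B - A‖ ≤ C) :
    Function.Injective B := by
  refine (injective_iff_map_eq_zero B).2 fun v hv => ?_
  by_contra hne
  have h1 : ‖v‖ ≤ K * ‖A v‖ := hA.le_mul_norm (map_zero A) v
  have h2 : ‖A v‖ ≤ C * ‖v‖ := by
    simpa [hv] using (B - A).le_of_opNorm_le hB v
  have h3 : K * ‖A v‖ ≤ K * (C * ‖v‖) := mul_le_mul_of_nonneg_left h2 K.2
  nlinarith [norm_pos_iff.2 hne]

/-- By the mean value inequality `f - A` is `C`-Lipschitz on the convex set, too little to cancel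
the expansion of `A` by at least `1 / K`. -/
theorem AntilipschitzWith.injOn_of_norm_fderiv_sub_le {E G : Type*} [NormedAddCommGroup E]
    [NormedSpace ℝ E] [NormedAddCommGroup G] [NormedSpace ℝ G] {A : E →L[ℝ] G} {K : NNReal}
    (hA : AntilipschitzWith K A) {C : ℝ} (hC : K * C < 1) {s : Set E} (hs : Convex ℝ s)
    {f : E → G} (hf : ∀ z ∈ s, DifferentiableAt ℝ f z) (hfA : ∀ z ∈ s, ‖fderiv ℝ f z - A‖ ≤ C) :
    InjOn f s := by
  intro a ha b hb hab
  by_contra hne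
  have h1 : ‖b - a‖ ≤ K * ‖A (b - a)‖ := hA.le_mul_norm (map_zero A) _
  have h2 : ‖A (b - a)‖ ≤ C * ‖b - a‖ := by
    have := hs.norm_image_sub_le_of_norm_hasFDerivWithin_le'
      (fun z hz => (hf z hz).hasFDerivAt.hasFDerivWithinAt) hfA ha hb
    rwa [hab, sub_self, zero_sub, norm_neg] at this
  have h3 : K * ‖A (b - a)‖ ≤ K * (C * ‖b - a‖) := mul_le_mul_of_nonneg_left h2 K.2
  nlinarith [norm_pos_iff.2 (sub_ne_zero.2 (Ne.symm hne))]

namespace SmoothMaps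

variable {n d : ℕ} {M : Type u} [TopologicalSpace M] [ChartedSpace (EuclideanSpace ℝ (Fin n)) M]

theorem eventually_norm_jet_sub_lt (c : CompactChart n M) (k : ℕ) (q : SmoothMaps n d M)
    {ε : ℝ} (hε : 0 < ε) : ∀ᶠ f in 𝓝 q, ∀ z ∈ c.carrier,
      ‖iteratedFDeriv ℝ k ((f - q : SmoothMaps n d M) ∘ c.chart.symm) z‖ < ε := by
  have hc : Continuous fun f : SmoothMaps n d M => ‖jet c k (f - q)‖ :=
    (continuous_norm (E := C(c.carrier,
      EuclideanSpace ℝ (Fin n) [×k]→L[ℝ] EuclideanSpace ℝ (Fin d)))).comp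
      ((continuous_jet c k).comp (continuous_sub_right q))
  have h0 : ‖jet c k (q - q)‖ = 0 := by
    rw [sub_self, map_zero]
    exact norm_zero (E := C(c.carrier,
      EuclideanSpace ℝ (Fin n) [×k]→L[ℝ] EuclideanSpace ℝ (Fin d)))
  filter_upwards [hc.continuousAt.eventually_lt_const (h0.trans_lt hε)] with f hf z hz
  exact ((jet c k (f - q)).norm_coe_le_norm ⟨z, hz⟩).trans_lt hf

theorem isEmbedding_iff_injective [CompactSpace M] (q : SmoothMaps n d M) :
    IsEmbedding q ↔ Function.Injective q :=
  ⟨fun h => h.injective, fun h => (q.contMDiff.continuous.isClosedEmbedding h).isEmbedding⟩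

variable [IsManifold (𝓡 n) ∞ M]

theorem tendsto_eval (q : SmoothMaps n d M) (x : M) :
    Tendsto (fun p : SmoothMaps n d M × M => p.1 p.2) (𝓝 q ×ˢ 𝓝 x) (𝓝 (q x)) := by
  set e := chartAt (EuclideanSpace ℝ (Fin n)) x with he
  obtain ⟨r, hr, hre⟩ := Metric.nhds_basis_closedBall.mem_iff.1
    (e.open_target.mem_nhds (mem_chart_target (EuclideanSpace ℝ (Fin n)) x))
  have hxe : x ∈ e.source := mem_chart_source _ x
  refine Metric.tendsto_nhds.2 fun ε hε => ?_
  have h1 := eventually_norm_jet_sub_lt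
    (CompactChart.at x _ (isCompact_closedBall _ r) hre) 0 q (half_pos hε)
  have h2 : ∀ᶠ y in 𝓝 x, dist (q y) (q x) < ε / 2 :=
    q.contMDiff.continuous.continuousAt (Metric.ball_mem_nhds _ (half_pos hε))
  have h3 : ∀ᶠ y in 𝓝 x, e y ∈ Metric.closedBall (e x) r :=
    (e.continuousAt hxe) (Metric.closedBall_mem_nhds _ hr)
  have h4 : ∀ᶠ y in 𝓝 x, y ∈ e.source := e.open_source.mem_nhds hxe
  filter_upwards [h1.prod_mk (h2.and (h3.and h4))] with ⟨f, y⟩ ⟨hf, hy, hye, hys⟩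
  have hfy : ‖f y - q y‖ < ε / 2 := by
    have := hf (e y) hye
    rw [norm_iteratedFDeriv_zero] at this
    change ‖f (e.symm (e y)) - q (e.symm (e y))‖ < ε / 2 at this
    rwa [e.left_inv hys] at this
  calc dist (f y) (q x) ≤ dist (f y) (q y) + dist (q y) (q x) := dist_triangle _ _ _
    _ < ε / 2 + ε / 2 := add_lt_add (by rwa [dist_eq_norm]) hy
    _ = ε := add_halves ε

theorem mfderiv_eq_fderiv_comp (f : SmoothMaps n d M) {y x : M}
    (hx : x ∈ (chartAt (EuclideanSpace ℝ (Fin n)) y).source) :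
    mfderiv (𝓡 n) 𝓘(ℝ, EuclideanSpace ℝ (Fin d)) f x =
      (fderiv ℝ (f ∘ (chartAt (EuclideanSpace ℝ (Fin n)) y).symm)
        (chartAt (EuclideanSpace ℝ (Fin n)) y x)).comp
        (mfderiv (𝓡 n) 𝓘(ℝ, EuclideanSpace ℝ (Fin n)) (extChartAt (𝓡 n) y) x) := by
  set e := chartAt (EuclideanSpace ℝ (Fin n)) y with he
  have heq : f =ᶠ[𝓝 x] (f ∘ e.symm) ∘ extChartAt (𝓡 n) y := by
    filter_upwards [e.open_source.mem_nhds hx] with z hz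
    simp [← he, e.left_inv hz]
  rw [heq.mfderiv_eq, mfderiv_comp (I' := 𝓘(ℝ, EuclideanSpace ℝ (Fin n))) (x := x),
    mfderiv_eq_fderiv]
  · rfl
  · exact ((contDiffAt_comp_symm f (IsManifold.chart_mem_maximalAtlas y)
      (e.map_source hx)).differentiableAt (by simp)).mdifferentiableAt
  · exact mdifferentiableAt_extChartAt hx

theorem injective_mfderiv_iff (f : SmoothMaps n d M) {y x : M}
    (hx : x ∈ (chartAt (EuclideanSpace ℝ (Fin n)) y).source) :
    Function.Injective (mfderiv (𝓡 n) 𝓘(ℝ, EuclideanSpace ℝ (Fin d)) f x) ↔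
      Function.Injective (fderiv ℝ (f ∘ (chartAt (EuclideanSpace ℝ (Fin n)) y).symm)
        (chartAt (EuclideanSpace ℝ (Fin n)) y x)) := by
  obtain ⟨L, hL⟩ := isInvertible_mfderiv_extChartAt (I := 𝓡 n) (x := y) (y := x)
    (by rwa [extChartAt_source])
  rw [mfderiv_eq_fderiv_comp f hx, ← hL]
  exact Function.Injective.of_comp_iff' _ L.bijective

theorem eventually_injective_mfderiv_and_injOn (q : SmoothMaps n d M) (y : M)
    (hq : Function.Injective (mfderiv (𝓡 n) 𝓘(ℝ, EuclideanSpace ℝ (Fin d)) q y)) :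
    ∃ O ∈ 𝓝 y, ∀ᶠ f : SmoothMaps n d M in 𝓝 q,
      (∀ x ∈ O, Function.Injective (mfderiv (𝓡 n) 𝓘(ℝ, EuclideanSpace ℝ (Fin d)) f x)) ∧
      InjOn f O := by
  set e := chartAt (EuclideanSpace ℝ (Fin n)) y with he
  have hem : e ∈ IsManifold.maximalAtlas (𝓡 n) ∞ M := IsManifold.chart_mem_maximalAtlas y
  have hy : e y ∈ e.target := mem_chart_target _ y
  have hye : y ∈ e.source := mem_chart_source _ y
  rw [injective_mfderiv_iff q hye] at hq
  set A := fderiv ℝ (q ∘ e.symm) (e y) with hA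
  obtain ⟨K, hK, hAK⟩ := (A : EuclideanSpace ℝ (Fin n) →ₗ[ℝ] EuclideanSpace ℝ (Fin d))
    |>.exists_antilipschitzWith (LinearMap.ker_eq_bot.2 hq)
  have hK' : (0 : ℝ) < K := hK
  -- Two errors of this size, the oscillation of the derivative of `q` on the ball and the distance
  -- from `f` to `q`, add up to `(2 * K)⁻¹`, and `K * (2 * K)⁻¹ = 1 / 2 < 1`.
  have hδ : 0 < (4 * K : ℝ)⁻¹ := by positivity
  have hcont : ContinuousAt (fderiv ℝ (q ∘ e.symm)) (e y) :=
    (contDiffAt_comp_symm q hem hy).continuousAt_fderiv (by simp)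
  obtain ⟨r, hr, hre⟩ := Metric.nhds_basis_closedBall.mem_iff.1
    (inter_mem (e.open_target.mem_nhds hy) (hcont (Metric.ball_mem_nhds _ hδ)))
  have hret : Metric.closedBall (e y) r ⊆ e.target := fun z hz => (hre hz).1
  refine ⟨e.source ∩ e ⁻¹' Metric.closedBall (e y) r, inter_mem (e.open_source.mem_nhds hye)
    ((e.continuousAt hye) (Metric.closedBall_mem_nhds _ hr)), ?_⟩
  filter_upwards [eventually_norm_jet_sub_lt
    (CompactChart.at y _ (isCompact_closedBall _ r) hret) 1 q hδ] with f hf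
  have hdiff : ∀ (g : SmoothMaps n d M), ∀ z ∈ Metric.closedBall (e y) r,
      DifferentiableAt ℝ (g ∘ e.symm) z := fun g z hz =>
    (contDiffAt_comp_symm g hem (hret hz)).differentiableAt (by simp)
  have hfA : ∀ z ∈ Metric.closedBall (e y) r, ‖fderiv ℝ (f ∘ e.symm) z - A‖ ≤ (2 * K : ℝ)⁻¹ := by
    intro z hz
    have h1 := hf z hz
    rw [norm_iteratedFDeriv_one] at h1
    change ‖fderiv ℝ (f ∘ e.symm - q ∘ e.symm) z‖ < _ at h1
    rw [fderiv_sub (hdiff f z hz) (hdiff q z hz)] at h1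
    have h2 : ‖fderiv ℝ (q ∘ e.symm) z - A‖ < (4 * K : ℝ)⁻¹ := mem_ball_iff_norm.1 (hre hz).2
    calc ‖fderiv ℝ (f ∘ e.symm) z - A‖
        = ‖(fderiv ℝ (f ∘ e.symm) z - fderiv ℝ (q ∘ e.symm) z) +
          (fderiv ℝ (q ∘ e.symm) z - A)‖ := by rw [sub_add_sub_cancel]
      _ ≤ (4 * K : ℝ)⁻¹ + (4 * K : ℝ)⁻¹ := (norm_add_le _ _).trans (add_le_add h1.le h2.le)
      _ = (2 * K : ℝ)⁻¹ := by field_simp; norm_num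
  have hKC : (K : ℝ) * (2 * K : ℝ)⁻¹ < 1 := by
    rw [mul_inv, mul_left_comm, mul_inv_cancel₀ hK'.ne']
    norm_num
  refine ⟨fun x hx => (injective_mfderiv_iff f hx.1).2
    (hAK.injective_of_norm_sub_le (A := A) hKC (hfA _ hx.2)), fun a ha b hb hab => ?_⟩
  have hinj := AntilipschitzWith.injOn_of_norm_fderiv_sub_le (A := A) hAK hKC
    (convex_closedBall (e y) r) (hdiff f) hfA
  refine e.injOn ha.1 hb.1 (hinj ha.2 hb.2 ?_)
  simpa [e.left_inv ha.1, e.left_inv hb.1] using hab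

theorem isOpen_imm [CompactSpace M] : IsOpen (Imm n d M) := by
  refine isOpen_iff_mem_nhds.2 fun q hq => ?_
  have h : ∀ᶠ f : SmoothMaps n d M in 𝓝 q, ∀ x ∈ (univ : Set M),
      Function.Injective (mfderiv (𝓡 n) 𝓘(ℝ, EuclideanSpace ℝ (Fin d)) f x) := by
    refine isCompact_univ.eventually_forall_of_forall_eventually fun y _ => ?_
    obtain ⟨O, hO, h⟩ := eventually_injective_mfderiv_and_injOn q y (hq y)
    rw [nhds_prod_eq]
    filter_upwards [h.prod_mk hO] with p hp using hp.1.1 _ hp.2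
  filter_upwards [h] with f hf x using hf x (mem_univ x)

/-- Pairs of distinct points with the same image do not accumulate, even when the map varies, at
the diagonal over an immersion. -/
theorem eventually_eq_of_apply_eq {q : SmoothMaps n d M} (hq : q ∈ Imm n d M) (y : M) :
    ∀ᶠ p : SmoothMaps n d M × (M × M) in 𝓝 q ×ˢ 𝓝 (y, y),
      p.1 p.2.1 = p.1 p.2.2 → p.2.1 = p.2.2 := by
  obtain ⟨O, hO, h⟩ := eventually_injective_mfderiv_and_injOn q y (hq y)
  filter_upwards [h.prod_mk (prod_mem_nhds hO hO)] with p hp hpe using hp.1.2 hp.2.1 hp.2.2 hpe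

/-- On a compact `M` only injectivity has to persist. Near the diagonal it does by the local
estimate, and elsewhere by joint continuity of evaluation; compactness of `M × M` combines the two.
-/
theorem isOpen_emb [CompactSpace M] : IsOpen (Emb n d M) := by
  refine isOpen_iff_mem_nhds.2 fun q hq => ?_
  have h : ∀ᶠ f : SmoothMaps n d M in 𝓝 q, ∀ x ∈ (univ : Set (M × M)),
      f x.1 = f x.2 → x.1 = x.2 := by
    refine isCompact_univ.eventually_forall_of_forall_eventually fun ⟨a, b⟩ _ => ?_
    rw [nhds_prod_eq]
    rcases eq_or_ne a b with rfl | hab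
    · exact eventually_eq_of_apply_eq hq.1 a
    · have ha : Tendsto (fun p : SmoothMaps n d M × (M × M) => p.1 p.2.1)
          (𝓝 q ×ˢ 𝓝 (a, b)) (𝓝 (q a)) :=
        (tendsto_eval q a).comp
          (tendsto_fst.prodMk (continuous_fst.continuousAt.tendsto.comp tendsto_snd))
      have hb : Tendsto (fun p : SmoothMaps n d M × (M × M) => p.1 p.2.2)
          (𝓝 q ×ˢ 𝓝 (a, b)) (𝓝 (q b)) :=
        (tendsto_eval q b).comp
          (tendsto_fst.prodMk (continuous_snd.continuousAt.tendsto.comp tendsto_snd))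
      filter_upwards [(ha.prodMk_nhds hb).eventually
        (isClosed_diagonal.isOpen_compl.mem_nhds (hq.2.injective.ne hab))] with p hp hpe
      exact (hp hpe).elim
  filter_upwards [h, isOpen_imm.mem_nhds hq.1] with f hf hfi
  exact ⟨hfi, (isEmbedding_iff_injective f).2 fun a b hab => hf (a, b) (mem_univ _) hab⟩

end SmoothMaps

/-! ### Openness of free immersions -/

/-- If `F i` converges to a locally injective map `q`, locally uniformly along an ultrafilter, then
continuous maps `φ i` with `F i ∘ φ i = F i` converge, locally uniformly, to a continuous map `ψ`
with `q ∘ ψ = q`. -/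
theorem exists_continuous_limit_of_comp_eq {ι X Y : Type*} [TopologicalSpace X]
    [TopologicalSpace Y] [CompactSpace X] [T2Space X] [T2Space Y] [LocallyConnectedSpace X]
    (U : Ultrafilter ι) {F : ι → X → Y} {q : X → Y}
    (hF : ∀ x, Tendsto (fun p : ι × X => F p.1 p.2) (U ×ˢ 𝓝 x) (𝓝 (q x)))
    (hq : ∀ x, ∃ O ∈ 𝓝 x, InjOn q O) {φ : ι → X → X} (hφ : ∀ i, Continuous (φ i))
    (hFφ : ∀ i x, F i (φ i x) = F i x) :
    ∃ ψ : X → X, Continuous ψ ∧ (∀ x, q (ψ x) = q x) ∧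
      ∀ x, Tendsto (fun p : ι × X => φ p.1 p.2) (U ×ˢ 𝓝 x) (𝓝 (ψ x)) := by
  have hlim : ∀ x, ∃ y, Tendsto (fun i => φ i x) U (𝓝 y) := fun x => by
    obtain ⟨y, -, hy⟩ := isCompact_univ.ultrafilter_le_nhds (U.map fun i => φ i x) (by simp)
    exact ⟨y, hy⟩
  choose ψ hψ using hlim
  have hFx : ∀ x, Tendsto (fun i => F i x) U (𝓝 (q x)) := fun x =>
    (hF x).comp (tendsto_id.prodMk tendsto_const_nhds)
  have hqψ : ∀ x, q (ψ x) = q x := fun x => by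
    have h : Tendsto (fun i => F i (φ i x)) U (𝓝 (q (ψ x))) :=
      (hF (ψ x)).comp (tendsto_id.prodMk (hψ x))
    simp only [hFφ] at h
    exact tendsto_nhds_unique h (hFx x)
  have hT : ∀ x, Tendsto (fun p : ι × X => φ p.1 p.2) (U ×ˢ 𝓝 x) (𝓝 (ψ x)) := by
    intro x V hV
    obtain ⟨O, hO, hOinj⟩ := hq (ψ x)
    obtain ⟨K, ⟨hK, hKclosed⟩, hKVO⟩ := (closed_nhds_basis (ψ x)).mem_iff.1 (inter_mem hV hO)
    have hS : IsCompact (frontier K) := isClosed_frontier.isCompact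
    -- `q` is injective on `K` and `ψ x` is interior to `K`, so the fibre of `q` through `ψ x`
    -- misses the frontier. By compactness of the frontier this separation persists for `F i` near
    -- `q` and points near `x`.
    have hsep : {p : (ι × X) × X | F p.1.1 p.1.2 ≠ F p.1.1 p.2} ∈
        (U ×ˢ 𝓝 x : Filter (ι × X)) ×ˢ 𝓝ˢ (frontier K) := by
      refine hS.mem_prod_nhdsSet_of_forall fun s hs => ?_
      have hne : q x ≠ q s := by
        rw [← hqψ x]
        intro h
        have hsK : s ∈ K := hKclosed.frontier_subset hs
        have := hOinj (hKVO (mem_of_mem_nhds hK)).2 (hKVO hsK).2 h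
        exact hs.2 (this ▸ mem_interior_iff_mem_nhds.2 hK)
      have h1 : Tendsto (fun p : (ι × X) × X => F p.1.1 p.1.2)
          ((U ×ˢ 𝓝 x : Filter (ι × X)) ×ˢ 𝓝 s) (𝓝 (q x)) := (hF x).comp tendsto_fst
      have h2 : Tendsto (fun p : (ι × X) × X => F p.1.1 p.2)
          ((U ×ˢ 𝓝 x : Filter (ι × X)) ×ˢ 𝓝 s) (𝓝 (q s)) :=
        (hF s).comp ((tendsto_fst.comp tendsto_fst).prodMk tendsto_snd)
      exact (h1.prodMk_nhds h2).eventually (isClosed_diagonal.isOpen_compl.mem_nhds hne)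
    obtain ⟨W, hW, S, hS', hWS⟩ := mem_prod_iff.1 hsep
    obtain ⟨A, hA, B₀, hB₀, hAB⟩ := mem_prod_iff.1 hW
    obtain ⟨B, ⟨hBo, hxB, hBc⟩, hBB₀⟩ :=
      (LocallyConnectedSpace.open_connected_basis x).mem_iff.1 hB₀
    have hA' : ∀ᶠ i in (U : Filter ι), φ i x ∈ interior K :=
      (hψ x).eventually (interior_mem_nhds.2 hK)
    refine mem_map.2 (mem_prod_iff.2 ⟨_, inter_mem hA hA', B, hBo.mem_nhds hxB, ?_⟩)
    rintro ⟨i, b⟩ ⟨⟨hiA, hix⟩, hb⟩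
    -- `φ i b'` lies in the `F i`-fibre of `b'`, which avoids the frontier of `K`. The connected set
    -- `φ i '' B` meets the interior at `φ i x`, so it cannot leave `K`.
    have hsub : φ i '' B ⊆ interior K ∪ Kᶜ := by
      rintro _ ⟨b', hb', rfl⟩
      by_contra hcon
      have hfr : φ i b' ∈ frontier K := by
        rw [hKclosed.frontier_eq]
        simp only [mem_union, mem_compl_iff, not_or, not_not] at hcon
        exact ⟨hcon.2, hcon.1⟩
      have := hWS (mk_mem_prod (hAB (mk_mem_prod hiA (hBB₀ hb')))
        (subset_of_mem_nhdsSet hS' hfr))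
      exact this (hFφ i b').symm
    have := (hBc.isPreconnected.image _ (hφ i).continuousOn).subset_left_of_subset_union
      isOpen_interior hKclosed.isOpen_compl
      (disjoint_compl_right.mono_left interior_subset) hsub ⟨_, mem_image_of_mem _ hxB, hix⟩
    exact (hKVO (interior_subset (this (mem_image_of_mem _ hb)))).1
  refine ⟨ψ, continuous_iff_continuousAt.2 fun x => ?_, hqψ, hT⟩
  refine (closed_nhds_basis (ψ x)).tendsto_right_iff.2 fun V ⟨hV, hVc⟩ => ?_
  obtain ⟨A, hA, B, hB, hAB⟩ := mem_prod_iff.1 (hT x hV)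
  filter_upwards [hB] with b hb
  exact hVc.mem_of_tendsto (hψ b)
    (mem_of_superset hA fun i hi => hAB (mk_mem_prod hi hb))

/-- If `L` is a linear left inverse of the derivative at `a`, then `L ∘ f` has derivative the
identity there, and the inverse function theorem applies to it. -/
theorem ContDiffAt.exists_contDiffAt_leftInverse {E G : Type*} [NormedAddCommGroup E]
    [NormedSpace ℝ E] [FiniteDimensional ℝ E] [NormedAddCommGroup G] [NormedSpace ℝ G]
    [FiniteDimensional ℝ G] {f : E → G} {a : E}
    (hf : ContDiffAt ℝ ∞ f a) (hinj : Function.Injective (fderiv ℝ f a)) :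
    ∃ h : G → E, ContDiffAt ℝ ∞ h (f a) ∧ ∀ᶠ z in 𝓝 a, h (f z) = z := by
  have : CompleteSpace E := FiniteDimensional.complete ℝ E
  obtain ⟨L, hL⟩ := (fderiv ℝ f a : E →ₗ[ℝ] G).exists_leftInverse_of_injective
    (LinearMap.ker_eq_bot.2 hinj)
  set g : E → E := L.toContinuousLinearMap ∘ f with hg
  have hgs : ContDiffAt ℝ ∞ g a := L.toContinuousLinearMap.contDiff.contDiffAt.comp a hf
  have hg' : HasFDerivAt g (ContinuousLinearEquiv.refl ℝ E : E →L[ℝ] E) a := by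
    have := L.toContinuousLinearMap.hasFDerivAt.comp a (hf.differentiableAt (by simp)).hasFDerivAt
    convert this using 1
    ext v
    exact (LinearMap.congr_fun hL v).symm
  refine ⟨hgs.localInverse hg' (by simp) ∘ L.toContinuousLinearMap,
    (hgs.to_localInverse hg' (by simp)).comp (f a)
      L.toContinuousLinearMap.contDiff.contDiffAt, ?_⟩
  exact (hgs.hasStrictFDerivAt' hg' (by simp)).eventually_left_inverse

namespace SmoothMaps

variable {n d : ℕ} {M : Type u} [TopologicalSpace M] [ChartedSpace (EuclideanSpace ℝ (Fin n)) M]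
  [IsManifold (𝓡 n) ∞ M]

/-- Read in a chart at `ψ x`, the map `ψ` is locally a smooth left inverse of `q` composed with `q`.
-/
theorem contMDiff_of_apply_eq_of_mem_imm {q : SmoothMaps n d M} (hq : q ∈ Imm n d M) {ψ : M → M}
    (hψ : Continuous ψ) (hqψ : ∀ x, q (ψ x) = q x) : ContMDiff (𝓡 n) (𝓡 n) ∞ ψ := by
  intro x
  set e := chartAt (EuclideanSpace ℝ (Fin n)) (ψ x) with he
  have hx : ψ x ∈ e.source := mem_chart_source _ _
  obtain ⟨h, hh, hinv⟩ := (contDiffAt_comp_symm q (IsManifold.chart_mem_maximalAtlas (ψ x))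
    (mem_chart_target _ _)).exists_contDiffAt_leftInverse
    ((injective_mfderiv_iff q hx).1 (hq (ψ x)))
  refine contMDiffAt_iff_target.2 ⟨hψ.continuousAt, ?_⟩
  have hh' : ContMDiffAt 𝓘(ℝ, EuclideanSpace ℝ (Fin d)) 𝓘(ℝ, EuclideanSpace ℝ (Fin n)) ∞ h
      (q x) := by
    have : q (e.symm (e (ψ x))) = q x := by rw [e.left_inv hx, hqψ]
    rw [← this]
    exact hh.contMDiffAt
  refine (hh'.comp x (q.contMDiff x)).congr_of_eventuallyEq ?_
  have hψx : Tendsto (fun y => e (ψ y)) (𝓝 x) (𝓝 (e (ψ x))) :=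
    (e.continuousAt hx).tendsto.comp hψ.continuousAt
  filter_upwards [hψx.eventually hinv, hψ.continuousAt (e.open_source.mem_nhds hx)] with y hy hys
  have : q (e.symm (e (ψ y))) = q y := by rw [e.left_inv hys, hqψ]
  simp only [Function.comp_apply, ← he] at hy ⊢
  rw [← this]
  exact hy.symm

theorem isOpen_immFree [CompactSpace M] [T2Space M] : IsOpen (ImmFree n d M) := by
  refine isOpen_iff_mem_nhds.2 fun q hq => ?_
  by_contra hcon
  have : LocallyConnectedSpace M :=
    ChartedSpace.locallyConnectedSpace (EuclideanSpace ℝ (Fin n)) M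
  have hU₀ : NeBot (𝓝 q ⊓ 𝓟 (ImmFree n d M)ᶜ) :=
    frequently_iff_neBot.1 (not_eventually.1 hcon)
  let U := Ultrafilter.of (𝓝 q ⊓ 𝓟 (ImmFree n d M)ᶜ)
  have hUq : (U : Filter (SmoothMaps n d M)) ≤ 𝓝 q :=
    (Ultrafilter.of_le _).trans inf_le_left
  have hUfree : (ImmFree n d M)ᶜ ∈ (U : Filter (SmoothMaps n d M)) :=
    (Ultrafilter.of_le _) (mem_inf_of_right (mem_principal_self _))
  -- The identity is the default where no nontrivial symmetry is needed, so that `φ f` exists for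
  -- every `f`.
  have hchoice : ∀ f : SmoothMaps n d M, ∃ φ : M ≃ₘ^∞⟮𝓡 n, 𝓡 n⟯ M, (∀ x, f (φ x) = f x) ∧
      (f ∈ Imm n d M → f ∉ ImmFree n d M → ∃ x, φ x ≠ x) := by
    intro f
    by_cases hf : f ∈ Imm n d M ∧ f ∉ ImmFree n d M
    · have h : ∃ φ : M ≃ₘ^∞⟮𝓡 n, 𝓡 n⟯ M, f ∘ φ = f ∧ φ ≠ Diffeomorph.refl (𝓡 n) M ∞ := by
        by_contra! h
        exact hf.2 ⟨hf.1, h⟩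
      obtain ⟨φ, hφ, hne⟩ := h
      refine ⟨φ, congr_fun hφ, fun _ _ => ?_⟩
      by_contra! h
      exact hne (Diffeomorph.ext h)
    · exact ⟨Diffeomorph.refl (𝓡 n) M ∞, fun _ => rfl, fun h1 h2 => (hf ⟨h1, h2⟩).elim⟩
  choose φ hφ hφne using hchoice
  have hφsymm : ∀ (f : SmoothMaps n d M) (x : M), f ((φ f).symm x) = f x := fun f x => by
    rw [← hφ f ((φ f).symm x), Diffeomorph.apply_symm_apply]
  have hF : ∀ x, Tendsto (fun p : SmoothMaps n d M × M => p.1 p.2) (U ×ˢ 𝓝 x) (𝓝 (q x)) :=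
    fun x => (tendsto_eval q x).mono_left (prod_mono_left _ hUq)
  have hqloc : ∀ x, ∃ O ∈ 𝓝 x, InjOn q O := fun x => by
    obtain ⟨O, hO, h⟩ := eventually_injective_mfderiv_and_injOn q x (hq.1 x)
    exact ⟨O, hO, h.self_of_nhds.2⟩
  obtain ⟨ψ, hψc, hqψ, hψ⟩ := exists_continuous_limit_of_comp_eq U
    (F := fun f x => f x) hF hqloc (φ := fun f => φ f) (fun f => (φ f).continuous) hφ
  obtain ⟨χ, hχc, hqχ, hχ⟩ := exists_continuous_limit_of_comp_eq U
    (F := fun f x => f x) hF hqloc (φ := fun f => (φ f).symm) (fun f => (φ f).symm.continuous)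
    hφsymm
  -- Convergence that is uniform near each point permits evaluation at moving points; this makes the
  -- limits of `φ f` and of its inverse mutually inverse.
  have hpt : ∀ (θ : SmoothMaps n d M → M → M) {τ : M → M},
      (∀ x, Tendsto (fun p : SmoothMaps n d M × M => θ p.1 p.2) (U ×ˢ 𝓝 x) (𝓝 (τ x))) →
      ∀ {z : SmoothMaps n d M → M} {x}, Tendsto z U (𝓝 x) →
        Tendsto (fun f => θ f (z f)) U (𝓝 (τ x)) := fun _ _ h z x hz =>
    (h x).comp (tendsto_id.prodMk hz)
  have hχψ : Function.LeftInverse χ ψ := fun x => by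
    have h := hpt (fun f => (φ f).symm) hχ (hpt (fun f => φ f) hψ (tendsto_const_nhds (x := x)))
    simp only [Diffeomorph.symm_apply_apply] at h
    exact tendsto_nhds_unique h tendsto_const_nhds
  have hψχ : Function.RightInverse χ ψ := fun x => by
    have h := hpt (fun f => φ f) hψ (hpt (fun f => (φ f).symm) hχ (tendsto_const_nhds (x := x)))
    simp only [Diffeomorph.apply_symm_apply] at h
    exact tendsto_nhds_unique h tendsto_const_nhds
  let Ψ : M ≃ₘ^∞⟮𝓡 n, 𝓡 n⟯ M :=
    { toEquiv := ⟨ψ, χ, hχψ, hψχ⟩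
      contMDiff_toFun := contMDiff_of_apply_eq_of_mem_imm hq.1 hψc hqψ
      contMDiff_invFun := contMDiff_of_apply_eq_of_mem_imm hq.1 hχc hqχ }
  have hΨ : Ψ = Diffeomorph.refl (𝓡 n) M ∞ := hq.2 Ψ (funext hqψ)
  have hψid : ∀ x, ψ x = x := fun x => DFunLike.congr_fun hΨ x
  have hmove : ∀ᶠ f in (U : Filter (SmoothMaps n d M)), ∃ x, φ f x ≠ x := by
    filter_upwards [hUfree, hUq (isOpen_imm.mem_nhds hq.1)] with f hf hfi using hφne f hfi hf
  obtain ⟨f₀, x₀, -⟩ := hmove.exists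
  have hz : ∃ z : SmoothMaps n d M → M, ∀ᶠ f in (U : Filter (SmoothMaps n d M)),
      φ f (z f) ≠ z f := by
    classical
    refine ⟨fun f => if h : ∃ x, φ f x ≠ x then h.choose else x₀, ?_⟩
    filter_upwards [hmove] with f hf
    rw [dif_pos hf]
    exact hf.choose_spec
  obtain ⟨z, hz⟩ := hz
  obtain ⟨x, -, hx⟩ := isCompact_univ.ultrafilter_le_nhds (U.map z) (by simp)
  have hzx : Tendsto z U (𝓝 x) := hx
  have hφz : Tendsto (fun f => φ f (z f)) U (𝓝 x) := by
    have h := hpt (fun f => φ f) hψ hzx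
    rwa [hψid] at h
  -- Both `φ f (z f)` and `z f` tend to `x`, although they are distinct with equal images under `f`.
  have hpair : Tendsto (fun f : SmoothMaps n d M => (f, (φ f (z f), z f))) U
      (𝓝 q ×ˢ 𝓝 (x, x)) := Tendsto.prodMk hUq (hφz.prodMk_nhds hzx)
  obtain ⟨f, hf, hfz⟩ := ((hpair.eventually (eventually_eq_of_apply_eq hq.1 x)).and hz).exists
  exact hfz (hf (hφ f (z f)))

end SmoothMaps

/-! ### Open subsets as Fréchet manifolds -/

/-- A map that agrees on an open set with a continuous linear map is smooth there. -/
theorem FrechetContDiffOn.of_eqOn_linear {G : Type v} [AddCommGroup G] [Module ℝ G]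
    [TopologicalSpace G] (k : ℕ) :
    ∀ {F : Type u} [AddCommGroup F] [Module ℝ F] [TopologicalSpace F] [ContinuousAdd F]
      [ContinuousSMul ℝ F] {U : Set F} (_ : IsOpen U) (L : F →L[ℝ] G) {f : F → G}
      (_ : EqOn f L U), FrechetContDiffOn k f U := by
  induction k with
  | zero =>
    intro F _ _ _ _ _ U _ L f hf
    exact L.continuous.continuousOn.congr hf
  | succ k ih =>
    intro F _ _ _ _ _ U hU L f hf
    -- The derivative `(x, h) ↦ L h` is again continuous linear, now on `F × F`; hence the induction
    -- generalizes over the space.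
    refine ⟨L.continuous.continuousOn.congr hf, fun p => L p.2, fun x hx h => ?_,
      ih (hU.prod isOpen_univ) (L.comp (ContinuousLinearMap.snd ℝ F F)) fun p _ => rfl⟩
    have hline : Tendsto (fun t : ℝ => x + t • h) (𝓝[≠] 0) (𝓝 x) := by
      have : Continuous fun t : ℝ => x + t • h := by fun_prop
      simpa using (this.tendsto 0).mono_left nhdsWithin_le_nhds
    refine tendsto_const_nhds.congr' ?_
    filter_upwards [hline (hU.mem_nhds hx), self_mem_nhdsWithin] with t ht ht0
    rw [hf ht, hf hx, map_add, add_sub_cancel_left, map_smul, smul_smul,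
      inv_mul_cancel₀ ht0, one_smul]

/-- Every chart in the atlas of `V` is the inclusion, so transition maps are restrictions of the
identity. -/
theorem IsFrechetSpace.isFrechetManifold_opens {F : Type u} [AddCommGroup F] [Module ℝ F]
    [TopologicalSpace F] (hF : IsFrechetSpace F) (V : TopologicalSpace.Opens F) :
    IsFrechetManifold F V where
  isFrechetSpace := hF
  t2Space := have := hF.t2Space; inferInstance
  smooth_transition := by
    have := hF.isTopologicalAddGroup
    have := hF.continuousSMul
    intro e he e' he' k
    refine FrechetContDiffOn.of_eqOn_linear k (OpenPartialHomeomorph.open_source _)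
      (ContinuousLinearMap.id ℝ F) fun x hx => ?_
    have hcoe : ∀ e ∈ atlas F V, ∀ y : V, e y = y := by
      intro e he y
      obtain ⟨_, ⟨z, rfl⟩, he⟩ := he
      obtain rfl := mem_singleton_iff.1 he
      rfl
    have h1 := e.right_inv (x := x) (by simpa using hx.1)
    rw [hcoe e he] at h1
    change e' (e.symm x) = x
    rw [hcoe e' he', h1]

theorem mainTheorem7 (n d : ℕ) (M : Type*) [TopologicalSpace M]
    [ChartedSpace (EuclideanSpace ℝ (Fin n)) M] [IsManifold (𝓡 n) ∞ M]
    [CompactSpace M] [T2Space M] :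
    IsFrechetSpace (SmoothMaps n d M) ∧
    (∃ hU : IsOpen (Imm n d M), IsFrechetManifold (SmoothMaps n d M)
      (⟨Imm n d M, hU⟩ : TopologicalSpace.Opens (SmoothMaps n d M))) ∧
    (∃ hU : IsOpen (ImmFree n d M), IsFrechetManifold (SmoothMaps n d M)
      (⟨ImmFree n d M, hU⟩ : TopologicalSpace.Opens (SmoothMaps n d M))) ∧
    (∃ hU : IsOpen (Emb n d M), IsFrechetManifold (SmoothMaps n d M)
      (⟨Emb n d M, hU⟩ : TopologicalSpace.Opens (SmoothMaps n d M))) := by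
  have hF : IsFrechetSpace (SmoothMaps n d M) := SmoothMaps.isFrechetSpace
  exact ⟨hF, ⟨SmoothMaps.isOpen_imm, hF.isFrechetManifold_opens _⟩,
    ⟨SmoothMaps.isOpen_immFree, hF.isFrechetManifold_opens _⟩,
    ⟨SmoothMaps.isOpen_emb, hF.isFrechetManifold_opens _⟩⟩
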